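/- Let $\mathcal A:\mathbb R^{n_1\times n_2}\to\mathbb R^m$ be a linear map. It satisfies a $k$-RIP with constant $\delta_k\in[0,1)$ if $(1-\delta_k)\|X\|_F^2\le\|\mathcal A(X)\|^2\le(1+\delta_k)\|X\|_F^2$ for every $X\in\mathbb R^{n_1\times n_2}$ of rank at most $k$. Given $b\in\mathbb R^m$ and $U_0\in\mathbb R^{n_1\times r}$, $V_0\in\mathbb R^{n_2\times r}$, the updating variant of GNMR is the iteration $$U_{t+1}=U_t+\tilde U_t,\qquad V_{t+1}=V_t+\tilde V_t,\qquad X_t=U_tV_t^\top,\qquad t=0,1,2,\dots,$$ where $(\tilde U_t,\tilde V_t)$ is, among all minimizers $(U,V)\in\mathbb R^{n_1\times r}\times\mathbb R^{n_2\times r}$ of $\|\mathcal A(U_tV^\top+UV_t^\top+U_tV_t^\top)-b\|^2$, the (unique) one with the smallest $\|U\|_F^2+\|V\|_F^2$. **Theorem.** For every $\delta\in(0,1)$ there is a constant $c_0>0$, depending only on $\delta$, such that the following holds for every $c_e\ge c_0$, all $n_1,n_2,m,r$, and every linear map $\mathcal A:\mathbb R^{n_1\times n_2}\to\mathbb R^m$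 that satisfies a $2r$-RIP with a constant $\delta_{2r}\le\delta$. Let $X^*\in\mathbb R^{n_1\times n_2}$ have rank $r$, let $\sigma_r^*$ be its $r$-th largest singular value, and let $b=\mathcal A(X^*)$. If $$\|U_0V_0^\top-X^*\|_F\le\frac{\sigma_r^*}{c_e}\quad\text{and}\quad\|U_0^\top U_0-V_0^\top V_0\|_F\le\frac{\sigma_r^*}{2c_e},$$ then the estimates $X_t$ of the updating variant of GNMR started at $(U_0,V_0)$ satisfy $$\|X_{t+1}-X^*\|_F\le\frac{c_e}{2\sigma_r^*}\,\|X_t-X^*\|_F^2\qquad\text{for all }t=0,1,2,\dots,$$ and consequently $X_t\to X^*$ as $t\to\infty$. -/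

import Mathlib

open scoped Matrix Topology

attribute [local instance] Matrix.frobeniusNormedAddCommGroup Matrix.frobeniusNormedSpace

noncomputable section

namespace GNMR

/-- The `i`-th largest singular value `σ_i(X)` of a real matrix, counted from `i = 1`. -/
def sigma {n₁ n₂ : ℕ} (i : ℕ) (X : Matrix (Fin n₁) (Fin n₂) ℝ) : ℝ :=
  (Matrix.toEuclideanLin X).singularValues (i - 1)

/-- `A` satisfies an `r`-RIP with constant `δ ∈ [0, 1)`. The norm of a matrix is the Frobenius norm,
the norm on `EuclideanSpace` is the Euclidean one. -/
def SatisfiesRIP {n₁ n₂ m : ℕ}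
    (A : Matrix (Fin n₁) (Fin n₂) ℝ →ₗ[ℝ] EuclideanSpace ℝ (Fin m)) (r : ℕ) (δ : ℝ) : Prop :=
  0 ≤ δ ∧ δ < 1 ∧
    ∀ X : Matrix (Fin n₁) (Fin n₂) ℝ, X.rank ≤ r →
      (1 - δ) * ‖X‖ ^ 2 ≤ ‖A X‖ ^ 2 ∧ ‖A X‖ ^ 2 ≤ (1 + δ) * ‖X‖ ^ 2

/-- A pair `Z = (U, V)` of factor matrices. -/
abbrev Factors (n₁ n₂ r : ℕ) : Type :=
  Matrix (Fin n₁) (Fin r) ℝ × Matrix (Fin n₂) (Fin r) ℝ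

/-- The estimate `U Vᵀ` given by a pair of factor matrices. -/
def estimate {n₁ n₂ r : ℕ} (Z : Factors n₁ n₂ r) : Matrix (Fin n₁) (Fin n₂) ℝ :=
  Z.1 * Z.2ᵀ

/-- The squared norm `‖U‖_F² + ‖V‖_F²` of a pair of factor matrices. -/
def sqNorm {n₁ n₂ r : ℕ} (Z : Factors n₁ n₂ r) : ℝ :=
  ‖Z.1‖ ^ 2 + ‖Z.2‖ ^ 2

/-- The pairs with `‖U Vᵀ - X*‖_F ≤ ε σ_r(X*)`. -/
def errBall {n₁ n₂ : ℕ} (r : ℕ) (Xstar : Matrix (Fin n₁) (Fin n₂) ℝ) (ε : ℝ) :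
    Set (Factors n₁ n₂ r) :=
  {Z | ‖estimate Z - Xstar‖ ≤ ε * sigma r Xstar}

/-- The pairs with `‖Uᵀ U - Vᵀ V‖_F ≤ δ σ_r(X*)`. -/
def balancedSet {n₁ n₂ : ℕ} (r : ℕ) (Xstar : Matrix (Fin n₁) (Fin n₂) ℝ) (δ : ℝ) :
    Set (Factors n₁ n₂ r) :=
  {Z | ‖Z.1ᵀ * Z.1 - Z.2ᵀ * Z.2‖ ≤ δ * sigma r Xstar}

/-- The least squares objective `‖A(U_t Vᵀ + U V_tᵀ - α U_t V_tᵀ) - b‖²` at `W = (U, V)`, where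
`Z = (U_t, V_t)` is the current iterate. -/
def objective {n₁ n₂ m r : ℕ}
    (A : Matrix (Fin n₁) (Fin n₂) ℝ →ₗ[ℝ] EuclideanSpace ℝ (Fin m))
    (b : EuclideanSpace ℝ (Fin m)) (α : ℝ) (Z W : Factors n₁ n₂ r) : ℝ :=
  ‖A (Z.1 * W.2ᵀ + W.1 * Z.2ᵀ - α • (Z.1 * Z.2ᵀ)) - b‖ ^ 2

/-- `W` is a minimizer of the least squares objective. -/
def IsLSQSolution {n₁ n₂ m r : ℕ}
    (A : Matrix (Fin n₁) (Fin n₂) ℝ →ₗ[ℝ] EuclideanSpace ℝ (Fin m))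
    (b : EuclideanSpace ℝ (Fin m)) (α : ℝ) (Z W : Factors n₁ n₂ r) : Prop :=
  ∀ W' : Factors n₁ n₂ r, objective A b α Z W ≤ objective A b α Z W'

/-- `W` is a minimizer of the least squares objective with the smallest norm. -/
def IsMinNormSolution {n₁ n₂ m r : ℕ}
    (A : Matrix (Fin n₁) (Fin n₂) ℝ →ₗ[ℝ] EuclideanSpace ℝ (Fin m))
    (b : EuclideanSpace ℝ (Fin m)) (α : ℝ) (Z W : Factors n₁ n₂ r) : Prop :=
  IsLSQSolution A b α Z W ∧
    ∀ W' : Factors n₁ n₂ r, IsLSQSolution A b α Z W' → sqNorm W ≤ sqNorm W'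

/-- The linear part of the least squares problem. -/
def linPart {n₁ n₂ m r : ℕ}
    (A : Matrix (Fin n₁) (Fin n₂) ℝ →ₗ[ℝ] EuclideanSpace ℝ (Fin m))
    (Z : Factors n₁ n₂ r) : Factors n₁ n₂ r →ₗ[ℝ] EuclideanSpace ℝ (Fin m) where
  toFun W := A (Z.1 * W.2ᵀ + W.1 * Z.2ᵀ)
  map_add' W W' := by
    rw [← map_add]
    congr 1
    simp only [Prod.fst_add, Prod.snd_add, Matrix.transpose_add, Matrix.mul_add, Matrix.add_mul]
    abel
  map_smul' c W := by
    rw [RingHom.id_apply, ← map_smul]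
    congr 1
    simp [Matrix.transpose_smul, smul_add]

theorem objective_eq {n₁ n₂ m r : ℕ}
    (A : Matrix (Fin n₁) (Fin n₂) ℝ →ₗ[ℝ] EuclideanSpace ℝ (Fin m))
    (b : EuclideanSpace ℝ (Fin m)) (α : ℝ) (Z W : Factors n₁ n₂ r) :
    objective A b α Z W = ‖(b + A (α • (Z.1 * Z.2ᵀ))) - linPart A Z W‖ ^ 2 := by
  have h : linPart A Z W = A (Z.1 * W.2ᵀ + W.1 * Z.2ᵀ) := rfl
  rw [objective, h, map_sub, ← norm_neg]
  congr 2
  abel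

/-- The least squares solutions form a nonempty fibre of the linear part. -/
theorem exists_fibre {n₁ n₂ m r : ℕ}
    (A : Matrix (Fin n₁) (Fin n₂) ℝ →ₗ[ℝ] EuclideanSpace ℝ (Fin m))
    (b : EuclideanSpace ℝ (Fin m)) (α : ℝ) (Z : Factors n₁ n₂ r) :
    ∃ W₀ : Factors n₁ n₂ r, ∀ W : Factors n₁ n₂ r,
      IsLSQSolution A b α Z W ↔ linPart A Z W = linPart A Z W₀ := by
  set c := b + A (α • (Z.1 * Z.2ᵀ)) with hc
  set K := LinearMap.range (linPart A Z) with hK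
  obtain ⟨W₀, hW₀⟩ : K.starProjection c ∈ K := Submodule.starProjection_apply_mem K c
  have horth : ∀ W : Factors n₁ n₂ r,
      objective A b α Z W = ‖c - linPart A Z W₀‖ ^ 2
        + ‖linPart A Z W₀ - linPart A Z W‖ ^ 2 := by
    intro W
    rw [objective_eq, ← hc]
    have h0 : inner ℝ (c - linPart A Z W₀) (linPart A Z W₀ - linPart A Z W) = 0 := by
      rw [hW₀]
      refine Submodule.starProjection_inner_eq_zero c _ ?_
      rw [← hW₀]
      exact K.sub_mem ⟨_, rfl⟩ ⟨_, rfl⟩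
    have h1 := norm_add_sq_real (c - linPart A Z W₀) (linPart A Z W₀ - linPart A Z W)
    rw [h0, sub_add_sub_cancel] at h1
    linarith
  refine ⟨W₀, fun W => ⟨fun h => ?_, fun h W' => ?_⟩⟩
  · have h1 := h W₀
    rw [horth W, horth W₀, sub_self, norm_zero] at h1
    have h2 : ‖linPart A Z W₀ - linPart A Z W‖ = 0 := by
      have := sq_nonneg ‖linPart A Z W₀ - linPart A Z W‖
      exact pow_eq_zero_iff (two_ne_zero) |>.1 (by linarith)
    exact (sub_eq_zero.1 (norm_eq_zero.1 h2)).symm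
  · rw [horth W, horth W', h, sub_self, norm_zero]
    have := sq_nonneg ‖linPart A Z W₀ - linPart A Z W'‖
    linarith

theorem norm_sq_eq {p q : ℕ} (M : Matrix (Fin p) (Fin q) ℝ) :
    ‖M‖ ^ 2 = ∑ i, ∑ j, M i j ^ 2 := by
  rw [Matrix.frobenius_norm_def, ← Real.sqrt_eq_rpow, Real.sq_sqrt (by positivity)]
  simp

theorem norm_sq_midpoint {p q : ℕ} (M N : Matrix (Fin p) (Fin q) ℝ) :
    ‖(1 / 2 : ℝ) • (M + N)‖ ^ 2 = (‖M‖ ^ 2 + ‖N‖ ^ 2) / 2 - ‖M - N‖ ^ 2 / 4 := by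
  simp only [norm_sq_eq, ← Finset.sum_add_distrib, Finset.sum_div, ← Finset.sum_sub_distrib]
  refine Finset.sum_congr rfl fun i _ => Finset.sum_congr rfl fun j _ => ?_
  simp only [Matrix.smul_apply, Matrix.add_apply, Matrix.sub_apply, smul_eq_mul]
  ring

/-- The minimal norm solution of the least squares problem exists and is unique. -/
theorem existsUnique_minNormSolution {n₁ n₂ m r : ℕ}
    (A : Matrix (Fin n₁) (Fin n₂) ℝ →ₗ[ℝ] EuclideanSpace ℝ (Fin m))
    (b : EuclideanSpace ℝ (Fin m)) (α : ℝ) (Z : Factors n₁ n₂ r) :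
    ∃! W : Factors n₁ n₂ r, IsMinNormSolution A b α Z W := by
  obtain ⟨W₀, hW₀⟩ := exists_fibre A b α Z
  have hcont : Continuous (sqNorm : Factors n₁ n₂ r → ℝ) := by
    unfold sqNorm
    fun_prop
  have hclosed : IsClosed {W : Factors n₁ n₂ r | IsLSQSolution A b α Z W} := by
    simp only [hW₀]
    exact isClosed_eq (linPart A Z).continuous_of_finiteDimensional continuous_const
  have : ProperSpace (Factors n₁ n₂ r) := FiniteDimensional.proper ℝ _
  have hbdd : Bornology.IsBounded {W : Factors n₁ n₂ r | sqNorm W ≤ sqNorm W₀} := by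
    refine (Metric.isBounded_closedBall (x := (0 : Factors n₁ n₂ r))
      (r := √(sqNorm W₀))).subset fun W hW => ?_
    rw [mem_closedBall_zero_iff]
    have hW' : ‖W.1‖ ^ 2 + ‖W.2‖ ^ 2 ≤ sqNorm W₀ := hW
    refine max_le ?_ ?_ <;> refine Real.le_sqrt_of_sq_le ?_
    · nlinarith [sq_nonneg ‖W.2‖]
    · nlinarith [sq_nonneg ‖W.1‖]
  have hcomp : IsCompact ({W : Factors n₁ n₂ r | IsLSQSolution A b α Z W} ∩
      {W | sqNorm W ≤ sqNorm W₀}) :=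
    Metric.isCompact_of_isClosed_isBounded
      (hclosed.inter (isClosed_le hcont continuous_const)) (hbdd.subset Set.inter_subset_right)
  obtain ⟨W, ⟨hW1, hW2⟩, hmin⟩ :=
    hcomp.exists_isMinOn ⟨W₀, (hW₀ W₀).2 rfl, le_refl (sqNorm W₀)⟩ hcont.continuousOn
  have hWmin : IsMinNormSolution A b α Z W := by
    refine ⟨hW1, fun W' hW' => ?_⟩
    by_cases h : sqNorm W' ≤ sqNorm W₀
    · exact hmin ⟨hW', h⟩
    · exact (show sqNorm W ≤ sqNorm W₀ from hW2).trans (not_le.1 h).le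
  refine ⟨W, hWmin, fun W' hW' => ?_⟩
  have hmid : IsLSQSolution A b α Z ((1 / 2 : ℝ) • (W' + W)) := by
    rw [hW₀, map_smul, map_add, (hW₀ W').1 hW'.1, (hW₀ W).1 hW1, ← two_smul ℝ, smul_smul]
    norm_num
  have h1 := hWmin.2 _ hmid
  have h2 := hW'.2 _ hmid
  have h3 : sqNorm ((1 / 2 : ℝ) • (W' + W)) =
      (sqNorm W' + sqNorm W) / 2 - (‖W'.1 - W.1‖ ^ 2 + ‖W'.2 - W.2‖ ^ 2) / 4 := by
    have e1 := norm_sq_midpoint W'.1 W.1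
    have e2 := norm_sq_midpoint W'.2 W.2
    simp only [sqNorm, Prod.smul_fst, Prod.smul_snd, Prod.fst_add, Prod.snd_add]
    rw [e1, e2]
    ring
  have p1 := sq_nonneg ‖W'.1 - W.1‖
  have p2 := sq_nonneg ‖W'.2 - W.2‖
  have q1 : ‖W'.1 - W.1‖ = 0 := (pow_eq_zero_iff two_ne_zero).1 (by linarith)
  have q2 : ‖W'.2 - W.2‖ = 0 := (pow_eq_zero_iff two_ne_zero).1 (by linarith)
  exact Prod.ext (sub_eq_zero.1 (norm_eq_zero.1 q1)) (sub_eq_zero.1 (norm_eq_zero.1 q2))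

/-- The minimal norm solution of the least squares problem at the iterate `Z`. -/
def minNormSolution {n₁ n₂ m r : ℕ}
    (A : Matrix (Fin n₁) (Fin n₂) ℝ →ₗ[ℝ] EuclideanSpace ℝ (Fin m))
    (b : EuclideanSpace ℝ (Fin m)) (α : ℝ) (Z : Factors n₁ n₂ r) : Factors n₁ n₂ r :=
  (existsUnique_minNormSolution A b α Z).choose

theorem isMinNormSolution_minNormSolution {n₁ n₂ m r : ℕ}
    (A : Matrix (Fin n₁) (Fin n₂) ℝ →ₗ[ℝ] EuclideanSpace ℝ (Fin m))
    (b : EuclideanSpace ℝ (Fin m)) (α : ℝ) (Z : Factors n₁ n₂ r) :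
    IsMinNormSolution A b α Z (minNormSolution A b α Z) :=
  (existsUnique_minNormSolution A b α Z).choose_spec.1

/-- The iterates `Z_t = (U_t, V_t)` of GNMR with parameter `α`, started at `Z₀`. -/
def iterates {n₁ n₂ m r : ℕ}
    (A : Matrix (Fin n₁) (Fin n₂) ℝ →ₗ[ℝ] EuclideanSpace ℝ (Fin m))
    (b : EuclideanSpace ℝ (Fin m)) (α : ℝ) (Z₀ : Factors n₁ n₂ r) : ℕ → Factors n₁ n₂ r
  | 0 => Z₀
  | t + 1 => ((1 - α) / 2) • iterates A b α Z₀ t + minNormSolution A b α (iterates A b α Z₀ t)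

end GNMR

end

/-!
Write `X = U Vᵀ` for the current estimate, `E = X* - X`, `e = ‖E‖`, `σ = σ_r(X*)`, and
`L(W) = U W₂ᵀ + W₁ Vᵀ` for the derivative of the product (`tangent`). A step computes the minimal
norm `W` minimizing `‖A(X + L(W) - X*)‖`, and the new estimate is `X + L(W) + W₁ W₂ᵀ`.

The range of `L` contains every `M - (1 - P) M (1 - R)`, where `P`, `R` are the orthogonal
projections to the column spaces of `U`, `V` (`exists_tangent_eq`). So some `W₀` leaves the
residual `-(1 - P) E (1 - R)`. As `X*` has rank `r`, this is a Schur complement type remainder,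
`-((1 - P) E) X*⁺ (E (1 - R))`, of norm at most `e² / σ` (`norm_residual_le`). Optimality of `W`
bounds `‖A(L(W) - L(W₀))‖` by twice the objective at `W₀`; since `L(W) - L(W₀)` has rank at most
`2 r`, the RIP turns this into `‖L(W) - L(W₀)‖ ≲ e² / σ` (`norm_tangent_sub_le`). The remaining term
is at most `‖W‖²`, and minimality of the norm gives `‖W‖ ≲ ‖L(W)‖ / √σ ≲ e / √σ`, provided that all
singular values of `U` and `V` are of order at least `√σ`. Hence the error after the step is at most
`C e² / σ` (`step_bounds`).

The singular values of the factors are controlled by balancedness: a product close to `X*` forces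
`‖U x‖ ‖V x‖ ≥ (σ / 2) ‖x‖²`, and `‖U x‖²`, `‖V x‖²` differ little if `Uᵀ U - Vᵀ V` is small
(`boundedBelow_of_near_of_balanced`). Balancedness persists because the minimal norm solution is
orthogonal to the kernel of `L`, in particular to all `(U G, -V Gᵀ)`, that is `W₁ᵀ U = Vᵀ W₂`; the
first order change of `Uᵀ U - Vᵀ V` therefore vanishes, and it drifts by at most `‖W‖² ≲ e² / σ` per
step (`IsMinNormSolution.balance_add`). These drifts are summable as the errors at least halve in
each step (`iterates_bounds`).
-/

namespace GNMR

open Matrix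

/-! ### Euclidean operator bounds against the Frobenius norm -/

section OperatorBounds

variable {p q r s : ℕ}

/-- `‖C x‖ ≤ κ ‖x‖` for the Euclidean norms, in squared form (so that `Fin q → ℝ`, which carries the
sup norm, can be used for the vectors). -/
def OpBound (κ : ℝ) (C : Matrix (Fin p) (Fin q) ℝ) : Prop :=
  ∀ x : Fin q → ℝ, (C *ᵥ x) ⬝ᵥ (C *ᵥ x) ≤ κ ^ 2 * (x ⬝ᵥ x)

/-- `τ ‖x‖ ≤ ‖C x‖` for the Euclidean norms, in squared form. For `τ > 0` this says that `C` has
full column rank and that its singular values are at least `τ`. -/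
def BoundedBelow (τ : ℝ) (C : Matrix (Fin p) (Fin q) ℝ) : Prop :=
  ∀ x : Fin q → ℝ, τ ^ 2 * (x ⬝ᵥ x) ≤ (C *ᵥ x) ⬝ᵥ (C *ᵥ x)

theorem dotProduct_self_nonneg_real (x : Fin p → ℝ) : 0 ≤ x ⬝ᵥ x :=
  Finset.sum_nonneg fun i _ => mul_self_nonneg (x i)

theorem dotProduct_sq_le (x y : Fin p → ℝ) : (x ⬝ᵥ y) ^ 2 ≤ (x ⬝ᵥ x) * (y ⬝ᵥ y) := by
  simpa only [dotProduct, sq] using Finset.sum_mul_sq_le_sq_mul_sq Finset.univ x y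

theorem mulVec_dotProduct_mulVec (C : Matrix (Fin p) (Fin q) ℝ) (x : Fin q → ℝ) (y : Fin p → ℝ) :
    (C *ᵥ x) ⬝ᵥ y = x ⬝ᵥ (Cᵀ *ᵥ y) := by
  rw [dotProduct_comm, dotProduct_mulVec, dotProduct_comm, mulVec_transpose]

theorem norm_sq_eq_sum_col (M : Matrix (Fin p) (Fin q) ℝ) :
    ‖M‖ ^ 2 = ∑ j, M.col j ⬝ᵥ M.col j := by
  rw [norm_sq_eq, Finset.sum_comm]
  simp [dotProduct, sq, Matrix.col]

theorem OpBound.norm_mul_le {κ : ℝ} (hκ : 0 ≤ κ) {C : Matrix (Fin p) (Fin q) ℝ} (hC : OpBound κ C)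
    (M : Matrix (Fin q) (Fin s) ℝ) : ‖C * M‖ ≤ κ * ‖M‖ := by
  refine le_of_sq_le_sq ?_ (by positivity)
  rw [mul_pow, norm_sq_eq_sum_col, norm_sq_eq_sum_col, Finset.mul_sum]
  exact Finset.sum_le_sum fun j _ => hC (M.col j)

theorem OpBound.transpose {κ : ℝ} {C : Matrix (Fin p) (Fin q) ℝ} (hC : OpBound κ C) :
    OpBound κ Cᵀ := by
  intro y
  have h1 : (Cᵀ *ᵥ y) ⬝ᵥ (Cᵀ *ᵥ y) = (C *ᵥ (Cᵀ *ᵥ y)) ⬝ᵥ y :=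
    (mulVec_dotProduct_mulVec C (Cᵀ *ᵥ y) y).symm
  have h2 := dotProduct_sq_le (C *ᵥ (Cᵀ *ᵥ y)) y
  have h3 := hC (Cᵀ *ᵥ y)
  rw [← h1] at h2
  have h4 := dotProduct_self_nonneg_real (Cᵀ *ᵥ y)
  have h5 := dotProduct_self_nonneg_real y
  have h6 := h2.trans (mul_le_mul_of_nonneg_right h3 h5)
  rcases h4.eq_or_lt with h | h
  · rw [← h]; positivity
  · refine le_of_mul_le_mul_left ?_ h
    linarith

theorem OpBound.norm_mul_le' {κ : ℝ} (hκ : 0 ≤ κ) {C : Matrix (Fin p) (Fin q) ℝ}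
    (hC : OpBound κ C) (M : Matrix (Fin s) (Fin p) ℝ) : ‖M * C‖ ≤ κ * ‖M‖ := by
  rw [← frobenius_norm_transpose, transpose_mul, ← frobenius_norm_transpose M]
  exact hC.transpose.norm_mul_le hκ Mᵀ

theorem opBound_norm (M : Matrix (Fin p) (Fin q) ℝ) : OpBound ‖M‖ M := by
  intro x
  have h : ∀ {k : ℕ} (v : Fin k → ℝ), v ⬝ᵥ v = ‖replicateCol (Fin 1) v‖ ^ 2 := fun v => by
    rw [norm_sq_eq_sum_col]; simp [Matrix.col, dotProduct]
  rw [h, h, replicateCol_mulVec, ← mul_pow]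
  gcongr
  exact frobenius_norm_mul _ _

theorem opBound_one_of_symm_idem {P : Matrix (Fin p) (Fin p) ℝ} (h1 : Pᵀ = P) (h2 : P * P = P) :
    OpBound 1 P := by
  intro x
  have e1 : (P *ᵥ x) ⬝ᵥ (P *ᵥ x) = x ⬝ᵥ (P *ᵥ x) := by
    rw [mulVec_dotProduct_mulVec, h1, mulVec_mulVec, h2]
  have e2 := dotProduct_sq_le x (P *ᵥ x)
  rw [← e1] at e2
  have e3 := dotProduct_self_nonneg_real (P *ᵥ x)
  rcases e3.eq_or_lt with h | h
  · rw [← h]; simpa using dotProduct_self_nonneg_real x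
  · refine le_of_mul_le_mul_right ?_ h
    linarith

theorem opBound_one_sub_of_symm_idem {P : Matrix (Fin p) (Fin p) ℝ} (h1 : Pᵀ = P)
    (h2 : P * P = P) : OpBound 1 (1 - P) :=
  opBound_one_of_symm_idem (by rw [transpose_sub, transpose_one, h1])
    (by rw [Matrix.mul_sub, Matrix.sub_mul, Matrix.sub_mul, h2]; simp)

/-- The Moore-Penrose inverse `Y⁺ = (Yᵀ Y)⁻¹ Yᵀ` of a matrix of full column rank: `Y Y⁺` is the
orthogonal projection to the column space. -/
theorem BoundedBelow.exists_pinv {τ : ℝ} (hτ : 0 < τ) {Y : Matrix (Fin p) (Fin r) ℝ}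
    (hY : BoundedBelow τ Y) :
    ∃ Yp : Matrix (Fin r) (Fin p) ℝ, Yp * Y = 1 ∧ (Y * Yp)ᵀ = Y * Yp ∧ OpBound (1 / τ) Yp := by
  have hinj : Function.Injective (Yᵀ * Y).mulVec := by
    rw [← coe_mulVecLin, injective_iff_map_eq_zero]
    intro x hx
    rw [mulVecLin_apply] at hx
    have h := hY x
    rw [mulVec_dotProduct_mulVec, mulVec_mulVec, hx, dotProduct_zero] at h
    have h1 := dotProduct_self_nonneg_real x
    exact dotProduct_self_eq_zero.1 (by nlinarith [pow_pos hτ 2])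
  have hu : IsUnit (Yᵀ * Y).det := (isUnit_iff_isUnit_det _).1 (mulVec_injective_iff_isUnit.1 hinj)
  have hinv : (Yᵀ * Y)⁻¹ * Yᵀ * Y = 1 := by rw [Matrix.mul_assoc, nonsing_inv_mul _ hu]
  have hsymm : (Y * ((Yᵀ * Y)⁻¹ * Yᵀ))ᵀ = Y * ((Yᵀ * Y)⁻¹ * Yᵀ) := by
    simp only [transpose_mul, transpose_transpose, transpose_nonsing_inv, Matrix.mul_assoc]
  refine ⟨(Yᵀ * Y)⁻¹ * Yᵀ, hinv, hsymm, fun z => ?_⟩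
  set Yp := (Yᵀ * Y)⁻¹ * Yᵀ
  have hidem : (Y * Yp) * (Y * Yp) = Y * Yp := by
    rw [Matrix.mul_assoc, ← Matrix.mul_assoc Yp, hinv, Matrix.one_mul]
  have h1 := opBound_one_of_symm_idem hsymm hidem z
  have h2 := hY (Yp *ᵥ z)
  rw [mulVec_mulVec] at h2
  rw [one_div, inv_pow, ← div_eq_inv_mul, le_div_iff₀ (by positivity)]
  linarith

end OperatorBounds

/-! ### Rank of a sum -/

section Rank

variable {p q : ℕ}

theorem rank_add_le (M N : Matrix (Fin p) (Fin q) ℝ) : (M + N).rank ≤ M.rank + N.rank := by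
  unfold Matrix.rank
  rw [mulVecLin_add]
  exact (Submodule.finrank_mono (LinearMap.range_add_le _ _)).trans
    (Submodule.finrank_add_le_finrank_add_finrank _ _)

end Rank

/-! ### Reduced singular value decomposition -/

section SingularValues

variable {n₁ n₂ : ℕ}

theorem rank_eq_finrank_range_toEuclideanLin (X : Matrix (Fin n₁) (Fin n₂) ℝ) :
    X.rank = Module.finrank ℝ (LinearMap.range (toEuclideanLin X)) :=
  rank_eq_finrank_range_toLin X (PiLp.basisFun 2 ℝ (Fin n₁)) (PiLp.basisFun 2 ℝ (Fin n₂))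

theorem sigma_pos {r : ℕ} (hr : 0 < r) {X : Matrix (Fin n₁) (Fin n₂) ℝ} (hX : X.rank = r) :
    0 < sigma r X := by
  rw [sigma, LinearMap.singularValues_pos_iff_lt_finrank_range,
    ← rank_eq_finrank_range_toEuclideanLin]
  omega

/-- An orthonormal basis of right singular vectors, as the columns of an orthogonal matrix. -/
theorem exists_orthogonal_singularVectors (X : Matrix (Fin n₁) (Fin n₂) ℝ) :
    ∃ P : Matrix (Fin n₂) (Fin n₂) ℝ, Pᵀ * P = 1 ∧
      (X * P)ᵀ * (X * P) = diagonal fun j : Fin n₂ => (toEuclideanLin X).singularValues j ^ 2 := by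
  set T := toEuclideanLin X with hT
  have hn : Module.finrank ℝ (EuclideanSpace ℝ (Fin n₂)) = n₂ := by simp
  set e := T.isSymmetric_adjoint_comp_self.eigenvectorBasis hn with he
  have hTe : ∀ j i, (X * of fun i j => e j i) i j = (T (e j)) i := fun j i => rfl
  refine ⟨of fun i j => e j i, ?_, ?_⟩
  · ext i j
    have h := orthonormal_iff_ite.1 e.orthonormal j i
    simp only [EuclideanSpace.inner_eq_star_dotProduct, star_trivial] at h
    rw [mul_apply, one_apply]
    simp only [eq_comm (a := i)]
    rw [← h]
    rfl
  · ext i j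
    have h : inner ℝ (T (e j)) (T (e i)) = T.singularValues j ^ 2 * inner ℝ (e j) (e i) := by
      rw [T.sq_singularValues_fin hn, ← LinearMap.adjoint_inner_left, ← LinearMap.comp_apply, he,
        LinearMap.IsSymmetric.apply_eigenvectorBasis, inner_smul_left]
      rfl
    rw [orthonormal_iff_ite.1 e.orthonormal j i, EuclideanSpace.inner_eq_star_dotProduct] at h
    rw [mul_apply, diagonal_apply]
    trans (T (e i)).ofLp ⬝ᵥ star (T (e j)).ofLp
    · rfl
    · rw [h]
      split_ifs with h1 h2 h2
      · rw [h1, mul_one]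
      · exact absurd h1.symm h2
      · exact absurd h2.symm h1
      · simp

/-- The reduced singular value decomposition, with the left factor `Y` not normalized: the columns
of `Q` are the first `r` right singular vectors, and those of `Y = X Q` are orthogonal of norms
`σ₁ ≥ … ≥ σ_r`. -/
theorem exists_reduced_svd {r : ℕ} {X : Matrix (Fin n₁) (Fin n₂) ℝ} (hX : X.rank = r) :
    ∃ (Y : Matrix (Fin n₁) (Fin r) ℝ) (Q : Matrix (Fin n₂) (Fin r) ℝ),
      X = Y * Qᵀ ∧ Qᵀ * Q = 1 ∧ BoundedBelow (sigma r X) Y := by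
  obtain ⟨P, hP, hXP⟩ := exists_orthogonal_singularVectors X
  have hr : r ≤ n₂ := hX ▸ X.rank_le_width
  set s := (toEuclideanLin X).singularValues
  have hcol : ∀ j : Fin n₂, r ≤ j → ∀ i, (X * P) i j = 0 := by
    intro j hj i
    have h1 : ((X * P)ᵀ * (X * P)) j j = 0 := by
      rw [hXP, diagonal_apply_eq, (toEuclideanLin X).singularValues_eq_zero_iff_le_finrank_range.2
        (by rwa [← rank_eq_finrank_range_toEuclideanLin, hX])]
      simp
    rw [mul_apply] at h1
    have h2 := (Finset.sum_eq_zero_iff_of_nonneg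
      (fun k _ => mul_self_nonneg ((X * P) k j))).1 h1 i (Finset.mem_univ i)
    exact mul_self_eq_zero.1 h2
  set f : Fin r → Fin n₂ := Fin.castLE hr
  have hf : Function.Injective f := Fin.castLE_injective hr
  refine ⟨(X * P).submatrix id f, P.submatrix id f, ?_, ?_, ?_⟩
  · have h1 : X = X * P * Pᵀ := by
      rw [Matrix.mul_assoc, mul_eq_one_comm.1 hP, Matrix.mul_one]
    rw (occs := .pos [1]) [h1]
    ext i k
    rw [mul_apply, mul_apply]
    symm
    refine Finset.sum_of_injOn f hf.injOn (by simp) (fun j _ hj => ?_) (fun _ _ => rfl)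
    rw [hcol j ?_ i, zero_mul]
    by_contra hlt
    exact hj ⟨⟨j, not_le.1 hlt⟩, by simp, rfl⟩
  · rw [transpose_submatrix, ← submatrix_mul _ _ f id f Function.bijective_id, hP]
    exact submatrix_one f hf
  · intro x
    rw [mulVec_dotProduct_mulVec, mulVec_mulVec, transpose_submatrix,
      ← submatrix_mul _ _ f id f Function.bijective_id, hXP, submatrix_diagonal _ _ hf]
    simp only [dotProduct, mulVec_diagonal, Finset.mul_sum]
    refine Finset.sum_le_sum fun i _ => ?_
    have h1 : sigma r X ≤ s (i : ℕ) :=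
      (toEuclideanLin X).singularValues_antitone (by have := i.2; omega)
    have h0 : 0 ≤ sigma r X := (toEuclideanLin X).singularValues_nonneg _
    have h2 := mul_le_mul_of_nonneg_right (pow_le_pow_left₀ h0 h1 2) (mul_self_nonneg (x i))
    calc sigma r X ^ 2 * (x i * x i) ≤ s (i : ℕ) ^ 2 * (x i * x i) := h2
      _ = _ := by simp only [Function.comp]; change _ = x i * (s (i : ℕ) ^ 2 * x i); ring

end SingularValues

/-! ### Singular values of nearly balanced factors -/

section Factors

variable {n₁ n₂ r : ℕ}

/-- If `U Vᵀ` is close to `Y Qᵀ`, whose nonzero singular values are at least `σ`, then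
`‖U x‖ ‖V x‖ ≥ (σ / 2) ‖x‖²`: write `x = Vᵀ w` with `w = Q z` in the row space of `Y Qᵀ`; then
`‖x‖² = ⟨V x, w⟩ ≤ ‖V x‖ ‖w‖`, and `‖U x‖ = ‖U Vᵀ w‖ ≥ (σ / 2) ‖w‖`. -/
theorem mul_lowerBound_of_near {Y : Matrix (Fin n₁) (Fin r) ℝ} {Q : Matrix (Fin n₂) (Fin r) ℝ}
    {σ : ℝ} (hσ : 0 < σ) (hQ : Qᵀ * Q = 1) (hY : BoundedBelow σ Y) {U : Matrix (Fin n₁) (Fin r) ℝ}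
    {V : Matrix (Fin n₂) (Fin r) ℝ} (hE : ‖U * Vᵀ - Y * Qᵀ‖ ≤ σ / 10) (x : Fin r → ℝ) :
    σ ^ 2 / 4 * (x ⬝ᵥ x) ^ 2 ≤ ((U *ᵥ x) ⬝ᵥ (U *ᵥ x)) * ((V *ᵥ x) ⬝ᵥ (V *ᵥ x)) := by
  have hQz : ∀ z : Fin r → ℝ, (Q *ᵥ z) ⬝ᵥ (Q *ᵥ z) = z ⬝ᵥ z := fun z => by
    rw [mulVec_dotProduct_mulVec, mulVec_mulVec, hQ, one_mulVec]
  have hlow : ∀ z : Fin r → ℝ, σ ^ 2 / 4 * (z ⬝ᵥ z) ≤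
      (U *ᵥ ((Vᵀ * Q) *ᵥ z)) ⬝ᵥ (U *ᵥ ((Vᵀ * Q) *ᵥ z)) := by
    intro z
    set c := U *ᵥ ((Vᵀ * Q) *ᵥ z) with hc
    set d := (U * Vᵀ - Y * Qᵀ) *ᵥ (Q *ᵥ z) with hd
    have h1 : Y *ᵥ z = c - d := by
      rw [hc, hd, mulVec_mulVec, mulVec_mulVec, ← sub_mulVec, Matrix.sub_mul, Matrix.mul_assoc Y,
        hQ, Matrix.mul_one, Matrix.mul_assoc U, sub_sub_cancel]
    have h2 := opBound_norm (U * Vᵀ - Y * Qᵀ) (Q *ᵥ z)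
    rw [← hd, hQz] at h2
    have h3 := hY z
    have hz := dotProduct_self_nonneg_real z
    have h4 : ‖U * Vᵀ - Y * Qᵀ‖ ^ 2 * (z ⬝ᵥ z) ≤ (σ / 10) ^ 2 * (z ⬝ᵥ z) := by gcongr
    -- parallelogram law, for `‖Y z‖² ≤ 2 ‖c‖² + 2 ‖d‖²`
    have h5 : (c - d) ⬝ᵥ (c - d) + (c + d) ⬝ᵥ (c + d) = 2 * (c ⬝ᵥ c) + 2 * (d ⬝ᵥ d) := by
      simp only [sub_dotProduct, dotProduct_sub, add_dotProduct, dotProduct_add]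
      ring
    have h6 := dotProduct_self_nonneg_real (c + d)
    rw [h1] at h3
    nlinarith [mul_nonneg (sq_nonneg σ) hz]
  have hinj : Function.Injective (Vᵀ * Q).mulVecLin := by
    rw [injective_iff_map_eq_zero]
    intro z hz
    rw [mulVecLin_apply] at hz
    have h := hlow z
    rw [hz, mulVec_zero, dotProduct_zero] at h
    have h1 := dotProduct_self_nonneg_real z
    have h2 := pow_pos hσ 2
    exact dotProduct_self_eq_zero.1 (by nlinarith)
  obtain ⟨z, rfl⟩ := LinearMap.injective_iff_surjective.1 hinj x
  rw [mulVecLin_apply]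
  set x := (Vᵀ * Q) *ᵥ z with hx
  have h1 : x ⬝ᵥ x = (V *ᵥ x) ⬝ᵥ (Q *ᵥ z) := by
    rw [mulVec_dotProduct_mulVec V, mulVec_mulVec]
  have h2 := dotProduct_sq_le (V *ᵥ x) (Q *ᵥ z)
  rw [← h1, hQz] at h2
  calc σ ^ 2 / 4 * (x ⬝ᵥ x) ^ 2 ≤ σ ^ 2 / 4 * (((V *ᵥ x) ⬝ᵥ (V *ᵥ x)) * (z ⬝ᵥ z)) := by gcongr
    _ = (σ ^ 2 / 4 * (z ⬝ᵥ z)) * ((V *ᵥ x) ⬝ᵥ (V *ᵥ x)) := by ring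
    _ ≤ _ := mul_le_mul_of_nonneg_right (hlow z) (dotProduct_self_nonneg_real _)

/-- Nearly balanced factors of a matrix close to `Y Qᵀ` have all singular values at least
`√σ / 2`. -/
theorem boundedBelow_of_near_of_balanced {Y : Matrix (Fin n₁) (Fin r) ℝ}
    {Q : Matrix (Fin n₂) (Fin r) ℝ} {σ : ℝ} (hσ : 0 < σ) (hQ : Qᵀ * Q = 1) (hY : BoundedBelow σ Y)
    {U : Matrix (Fin n₁) (Fin r) ℝ} {V : Matrix (Fin n₂) (Fin r) ℝ}
    (hE : ‖U * Vᵀ - Y * Qᵀ‖ ≤ σ / 10) (hB : ‖Uᵀ * U - Vᵀ * V‖ ≤ σ / 10) :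
    BoundedBelow (√σ / 2) U ∧ BoundedBelow (√σ / 2) V := by
  have hτ : (√σ / 2) ^ 2 = σ / 4 := by rw [div_pow, Real.sq_sqrt hσ.le]; norm_num
  have key : ∀ x : Fin r → ℝ, σ / 4 * (x ⬝ᵥ x) ≤ (U *ᵥ x) ⬝ᵥ (U *ᵥ x) ∧
      σ / 4 * (x ⬝ᵥ x) ≤ (V *ᵥ x) ⬝ᵥ (V *ᵥ x) := by
    intro x
    have h1 := mul_lowerBound_of_near hσ hQ hY hE x
    have hw := dotProduct_self_nonneg_real x
    have hp := dotProduct_self_nonneg_real (U *ᵥ x)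
    have hq := dotProduct_self_nonneg_real (V *ᵥ x)
    have h2 : (U *ᵥ x) ⬝ᵥ (U *ᵥ x) - (V *ᵥ x) ⬝ᵥ (V *ᵥ x) = x ⬝ᵥ ((Uᵀ * U - Vᵀ * V) *ᵥ x) := by
      rw [mulVec_dotProduct_mulVec, mulVec_dotProduct_mulVec, mulVec_mulVec, mulVec_mulVec,
        sub_mulVec, dotProduct_sub]
    have h3 : |(U *ᵥ x) ⬝ᵥ (U *ᵥ x) - (V *ᵥ x) ⬝ᵥ (V *ᵥ x)| ≤ σ / 10 * (x ⬝ᵥ x) := by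
      refine abs_le_of_sq_le_sq ?_ (by positivity)
      rw [h2]
      refine (dotProduct_sq_le _ _).trans ?_
      have h4 := opBound_norm (Uᵀ * U - Vᵀ * V) x
      calc (x ⬝ᵥ x) * _ ≤ (x ⬝ᵥ x) * ((σ / 10) ^ 2 * (x ⬝ᵥ x)) := by
            refine mul_le_mul_of_nonneg_left (h4.trans ?_) hw
            gcongr
        _ = _ := by ring
    generalize (U *ᵥ x) ⬝ᵥ (U *ᵥ x) = p at *
    generalize (V *ᵥ x) ⬝ᵥ (V *ᵥ x) = q at *
    generalize x ⬝ᵥ x = w at *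
    have h4 := abs_le.1 h3
    have hs : 0 ≤ σ * w := by positivity
    -- If one of `p`, `q` is below `σ w / 4`, the other is below `(1 / 4 + 1 / 10) σ w`, and the
    -- product is less than `(σ w / 2)²`.
    constructor <;> by_contra hlt <;> push Not at hlt <;> nlinarith
  exact ⟨fun x => by rw [hτ]; exact (key x).1, fun x => by rw [hτ]; exact (key x).2⟩

end Factors

/-! ### The linearized product and its range -/

section Tangent

variable {n₁ n₂ m r : ℕ}

/-- The derivative `W ↦ U W₂ᵀ + W₁ Vᵀ` of `(U, V) ↦ U Vᵀ` at `Z = (U, V)`. -/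
def tangent (Z W : Factors n₁ n₂ r) : Matrix (Fin n₁) (Fin n₂) ℝ :=
  Z.1 * W.2ᵀ + W.1 * Z.2ᵀ

theorem tangent_sub (Z W W' : Factors n₁ n₂ r) :
    tangent Z (W - W') = tangent Z W - tangent Z W' := by
  simp only [tangent, Prod.fst_sub, Prod.snd_sub, transpose_sub, Matrix.mul_sub, Matrix.sub_mul]
  abel

theorem tangent_rank_le (Z W : Factors n₁ n₂ r) : (tangent Z W).rank ≤ 2 * r := by
  refine (rank_add_le _ _).trans ?_
  have h1 := (rank_mul_le_left Z.1 W.2ᵀ).trans Z.1.rank_le_width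
  have h2 := (rank_mul_le_left W.1 Z.2ᵀ).trans W.1.rank_le_width
  omega

theorem estimate_add (Z W : Factors n₁ n₂ r) :
    estimate (Z + W) = estimate Z + tangent Z W + W.1 * W.2ᵀ := by
  simp only [estimate, tangent, Prod.fst_add, Prod.snd_add, transpose_add, Matrix.mul_add,
    Matrix.add_mul]
  abel

theorem norm_sub_projections_le {P : Matrix (Fin n₁) (Fin n₁) ℝ} {R : Matrix (Fin n₂) (Fin n₂) ℝ}
    (hP : Pᵀ = P) (hP2 : P * P = P) (hR : Rᵀ = R) (hR2 : R * R = R)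
    (M : Matrix (Fin n₁) (Fin n₂) ℝ) : ‖(1 - P) * M * (1 - R)‖ ≤ ‖M‖ := by
  have h1 := (opBound_one_sub_of_symm_idem hP hP2).norm_mul_le zero_le_one M
  have h2 := (opBound_one_sub_of_symm_idem hR hR2).norm_mul_le' zero_le_one ((1 - P) * M)
  linarith

/-- The range of `tangent (U, V)` consists of the matrices `M` with `(1 - P) M (1 - R) = 0`, where
`P` and `R` are the orthogonal projections to the column spaces of `U` and `V`, and a preimage of
`M - (1 - P) M (1 - R)` with small factors is `(M (V⁺)ᵀ, (U⁺ M (1 - R))ᵀ)`. -/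
theorem exists_tangent_eq {τ : ℝ} (hτ : 0 < τ) {Z : Factors n₁ n₂ r} (hU : BoundedBelow τ Z.1)
    (hV : BoundedBelow τ Z.2) :
    ∃ (P : Matrix (Fin n₁) (Fin n₁) ℝ) (R : Matrix (Fin n₂) (Fin n₂) ℝ),
      Pᵀ = P ∧ P * P = P ∧ Rᵀ = R ∧ R * R = R ∧ (1 - P) * Z.1 = 0 ∧ Z.2ᵀ * (1 - R) = 0 ∧
      ∀ M : Matrix (Fin n₁) (Fin n₂) ℝ, ∃ W : Factors n₁ n₂ r,
        tangent Z W = M - (1 - P) * M * (1 - R) ∧ ‖W.1‖ ≤ 1 / τ * ‖M‖ ∧ ‖W.2‖ ≤ 1 / τ * ‖M‖ := by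
  obtain ⟨Up, hU1, hU2, hU3⟩ := hU.exists_pinv hτ
  obtain ⟨Vp, hV1, hV2, hV3⟩ := hV.exists_pinv hτ
  have hτ' : 0 ≤ 1 / τ := by positivity
  have iP : Z.1 * Up * (Z.1 * Up) = Z.1 * Up := by
    rw [Matrix.mul_assoc, ← Matrix.mul_assoc Up, hU1, Matrix.one_mul]
  have iR : Z.2 * Vp * (Z.2 * Vp) = Z.2 * Vp := by
    rw [Matrix.mul_assoc, ← Matrix.mul_assoc Vp, hV1, Matrix.one_mul]
  have hR : Vpᵀ * Z.2ᵀ = Z.2 * Vp := by rw [← transpose_mul, hV2]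
  refine ⟨Z.1 * Up, Z.2 * Vp, hU2, iP, hV2, iR, ?_, ?_, fun M => ?_⟩
  · rw [Matrix.sub_mul, Matrix.mul_assoc, hU1, Matrix.mul_one, Matrix.one_mul, sub_self]
  · rw [← hR, Matrix.mul_sub, ← Matrix.mul_assoc, ← transpose_mul, hV1, transpose_one,
      Matrix.one_mul, Matrix.mul_one, sub_self]
  · refine ⟨(M * Vpᵀ, (Up * (M * (1 - Z.2 * Vp)))ᵀ), ?_, ?_, ?_⟩
    · simp only [tangent, transpose_transpose]
      rw [Matrix.mul_assoc M, hR]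
      simp only [Matrix.mul_sub, Matrix.sub_mul, Matrix.mul_one, Matrix.one_mul, Matrix.mul_assoc]
      abel
    · exact hV3.transpose.norm_mul_le' hτ' M
    · rw [frobenius_norm_transpose]
      refine (hU3.norm_mul_le hτ' _).trans (mul_le_mul_of_nonneg_left ?_ hτ')
      simpa using (opBound_one_sub_of_symm_idem hV2 iR).norm_mul_le' zero_le_one M

/-- If `P X = X = X R`, then the part of `X* - X` (with `X* = Y Qᵀ`) that the projections `P`, `R` do
not see is quadratically small: with `E = X* - X` it equals
`(1 - P) X* X*⁺ X* (1 - R) = ((1 - P) E) X*⁺ (E (1 - R))`. -/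
theorem norm_residual_le {Y : Matrix (Fin n₁) (Fin r) ℝ} {Q : Matrix (Fin n₂) (Fin r) ℝ} {σ : ℝ}
    (hσ : 0 < σ) (hQ : Qᵀ * Q = 1) (hY : BoundedBelow σ Y)
    {P : Matrix (Fin n₁) (Fin n₁) ℝ} {R : Matrix (Fin n₂) (Fin n₂) ℝ}
    (hP : Pᵀ = P) (hP2 : P * P = P) (hR : Rᵀ = R) (hR2 : R * R = R)
    {X : Matrix (Fin n₁) (Fin n₂) ℝ} (hPX : (1 - P) * X = 0) (hXR : X * (1 - R) = 0) :
    ‖(1 - P) * (Y * Qᵀ - X) * (1 - R)‖ ≤ ‖X - Y * Qᵀ‖ ^ 2 / σ := by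
  obtain ⟨Yp, hY1, -, hY3⟩ := hY.exists_pinv hσ
  have hpinv : OpBound (1 / σ) (Q * Yp) := fun x => by
    rw [← mulVec_mulVec, mulVec_dotProduct_mulVec, mulVec_mulVec, hQ, one_mulVec]
    exact hY3 x
  have e1 : (1 - P) * (Y * Qᵀ) = (1 - P) * (Y * Qᵀ - X) := by rw [Matrix.mul_sub, hPX, sub_zero]
  have e2 : Y * Qᵀ * (1 - R) = (Y * Qᵀ - X) * (1 - R) := by rw [Matrix.sub_mul, hXR, sub_zero]
  have e3 : Y * Qᵀ * (Q * Yp) * (Y * Qᵀ) = Y * Qᵀ := by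
    have h1 : Y * Qᵀ * (Q * Yp) = Y * Yp := by
      rw [Matrix.mul_assoc, ← Matrix.mul_assoc Qᵀ, hQ, Matrix.one_mul]
    rw [h1, Matrix.mul_assoc, ← Matrix.mul_assoc Yp, hY1, Matrix.one_mul]
  have e4 : (1 - P) * (Y * Qᵀ - X) * (1 - R) =
      (1 - P) * (Y * Qᵀ - X) * (Q * Yp) * ((Y * Qᵀ - X) * (1 - R)) := by
    rw [← e1, ← e2]
    calc (1 - P) * (Y * Qᵀ) * (1 - R) = (1 - P) * (Y * Qᵀ * (Q * Yp) * (Y * Qᵀ)) * (1 - R) := by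
          rw [e3]
      _ = _ := by simp only [Matrix.mul_assoc]
  have n1 := (opBound_one_sub_of_symm_idem hP hP2).norm_mul_le zero_le_one (Y * Qᵀ - X)
  have n2 := (opBound_one_sub_of_symm_idem hR hR2).norm_mul_le' zero_le_one (Y * Qᵀ - X)
  have n3 := hpinv.norm_mul_le' (by positivity) ((1 - P) * (Y * Qᵀ - X))
  rw [e4, norm_sub_rev X]
  rw [one_mul] at n1 n2
  calc _ ≤ ‖(1 - P) * (Y * Qᵀ - X) * (Q * Yp)‖ * ‖(Y * Qᵀ - X) * (1 - R)‖ :=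
        frobenius_norm_mul _ _
    _ ≤ (1 / σ * ‖Y * Qᵀ - X‖) * ‖Y * Qᵀ - X‖ := by
        gcongr
        exact n3.trans (by gcongr)
    _ = _ := by ring

end Tangent

/-! ### Minimal norm solutions -/

section MinimalNorm

variable {n₁ n₂ m r : ℕ} {A : Matrix (Fin n₁) (Fin n₂) ℝ →ₗ[ℝ] EuclideanSpace ℝ (Fin m)}
  {b : EuclideanSpace ℝ (Fin m)} {α : ℝ} {Z W : Factors n₁ n₂ r}

theorem IsMinNormSolution.sqNorm_le (hW : IsMinNormSolution A b α Z W) {W' : Factors n₁ n₂ r}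
    (h : tangent Z W' = tangent Z W) : sqNorm W ≤ sqNorm W' := by
  refine hW.2 W' fun V => ?_
  have h1 := hW.1 V
  rw [objective_eq] at h1 ⊢
  have h2 : linPart A Z W' = linPart A Z W := congrArg A h
  rwa [h2]

theorem norm_sq_eq_trace {p q : ℕ} (M : Matrix (Fin p) (Fin q) ℝ) : ‖M‖ ^ 2 = (Mᵀ * M).trace := by
  rw [norm_sq_eq_sum_col]
  rfl

theorem norm_add_smul_sq {p q : ℕ} (M N : Matrix (Fin p) (Fin q) ℝ) (s : ℝ) :
    ‖M + s • N‖ ^ 2 = ‖M‖ ^ 2 + 2 * s * (Mᵀ * N).trace + s ^ 2 * ‖N‖ ^ 2 := by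
  have h : (Nᵀ * M).trace = (Mᵀ * N).trace := by
    rw [← trace_transpose, transpose_mul, transpose_transpose]
  simp only [norm_sq_eq_trace, transpose_add, transpose_smul, Matrix.mul_add, Matrix.add_mul,
    Matrix.mul_smul, Matrix.smul_mul, trace_add, trace_smul, smul_eq_mul, h]
  ring

/-- The minimal norm solution is orthogonal to the directions `(U G, -V Gᵀ)` along which `U Vᵀ` is
constant to first order. -/
theorem IsMinNormSolution.transpose_mul_eq (hW : IsMinNormSolution A b α Z W) :
    W.1ᵀ * Z.1 = Z.2ᵀ * W.2 := by
  set G := W.1ᵀ * Z.1 - Z.2ᵀ * W.2 with hG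
  have hvar : ∀ s : ℝ,
      0 ≤ s * (2 * ‖G‖ ^ 2) + s ^ 2 * (‖Z.1 * Gᵀ‖ ^ 2 + ‖Z.2 * G‖ ^ 2) := by
    intro s
    have h1 : tangent Z (W.1 + s • (Z.1 * Gᵀ), W.2 + (-s) • (Z.2 * G)) = tangent Z W := by
      simp only [tangent, transpose_add, transpose_smul, transpose_mul, Matrix.mul_add,
        Matrix.add_mul, Matrix.mul_smul, Matrix.smul_mul, Matrix.mul_assoc, neg_smul,
        transpose_neg, Matrix.mul_neg]
      abel
    have h2 := hW.sqNorm_le h1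
    rw [sqNorm, sqNorm, norm_add_smul_sq, norm_add_smul_sq] at h2
    have h3 : (W.1ᵀ * (Z.1 * Gᵀ)).trace - (W.2ᵀ * (Z.2 * G)).trace = ‖G‖ ^ 2 := by
      have h4 : (W.2ᵀ * (Z.2 * G)).trace = (Z.2ᵀ * W.2 * Gᵀ).trace := by
        rw [← trace_transpose, transpose_mul, transpose_mul, transpose_transpose, trace_mul_comm,
          Matrix.mul_assoc, trace_mul_comm, Matrix.mul_assoc, trace_mul_comm, Matrix.mul_assoc]
      rw [h4, ← Matrix.mul_assoc, ← trace_sub, ← Matrix.sub_mul, ← hG,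
        ← frobenius_norm_transpose G, norm_sq_eq_trace, transpose_transpose]
    rw [← h3]
    linarith
  have hzero : ‖G‖ ^ 2 ≤ 0 := by
    set g := ‖G‖ ^ 2
    set K := ‖Z.1 * Gᵀ‖ ^ 2 + ‖Z.2 * G‖ ^ 2
    have hK : 0 ≤ K := by positivity
    have hg : 0 ≤ g := sq_nonneg _
    -- the quadratic polynomial `2 g s + K s²` is nonpositive at `s = -g / (K + 1)`
    have h := hvar (-g / (K + 1))
    have h1 : -g / (K + 1) * (2 * g) + (-g / (K + 1)) ^ 2 * K =
        -(g ^ 2 * (K + 2)) / (K + 1) ^ 2 := by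
      field_simp
      ring
    rw [h1, le_div_iff₀ (by positivity)] at h
    nlinarith [mul_nonneg (sq_nonneg g) hK]
  exact sub_eq_zero.1 (norm_eq_zero.1 (pow_eq_zero_iff two_ne_zero |>.1
    (le_antisymm hzero (sq_nonneg _))))

/-- A minimal norm step changes `Uᵀ U - Vᵀ V` only to second order. -/
theorem IsMinNormSolution.balance_add (hW : IsMinNormSolution A b α Z W) :
    (Z + W).1ᵀ * (Z + W).1 - (Z + W).2ᵀ * (Z + W).2 =
      (Z.1ᵀ * Z.1 - Z.2ᵀ * Z.2) + (W.1ᵀ * W.1 - W.2ᵀ * W.2) := by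
  have h1 := hW.transpose_mul_eq
  have h2 : Z.1ᵀ * W.1 = W.2ᵀ * Z.2 := by
    simpa only [transpose_mul, transpose_transpose] using congrArg transpose h1
  simp only [Prod.fst_add, Prod.snd_add, transpose_add, Matrix.mul_add, Matrix.add_mul, h1, h2]
  abel

theorem norm_balance_le_sqNorm (W : Factors n₁ n₂ r) :
    ‖W.1ᵀ * W.1 - W.2ᵀ * W.2‖ ≤ sqNorm W := by
  refine (norm_sub_le _ _).trans (add_le_add ?_ ?_) <;>
  · refine (frobenius_norm_mul _ _).trans ?_
    rw [frobenius_norm_transpose, sq]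

theorem norm_mul_transpose_le_sqNorm (W : Factors n₁ n₂ r) : ‖W.1 * W.2ᵀ‖ ≤ sqNorm W := by
  refine (frobenius_norm_mul _ _).trans ?_
  rw [frobenius_norm_transpose, sqNorm]
  nlinarith [sq_nonneg (‖W.1‖ - ‖W.2‖), sq_nonneg ‖W.1‖, sq_nonneg ‖W.2‖]

end MinimalNorm

/-! ### One step of the iteration -/

section Step

variable {n₁ n₂ m r : ℕ} {A : Matrix (Fin n₁) (Fin n₂) ℝ →ₗ[ℝ] EuclideanSpace ℝ (Fin m)}
  {δ δ' : ℝ}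

/-- A least squares step differs from any competitor `W₀` whose residual has rank at most `2 r` by at
most a multiple of that residual. The RIP is applied only to `tangent Z (W - W₀)`, of rank at most
`2 r`, and to the residual of `W₀`; the residual of `W` itself may have rank `3 r`. -/
theorem norm_tangent_sub_le (hδ1 : δ < 1) (hA : SatisfiesRIP A (2 * r) δ') (hδ' : δ' ≤ δ)
    {Xstar : Matrix (Fin n₁) (Fin n₂) ℝ} {Z W W₀ : Factors n₁ n₂ r}
    (hW : IsLSQSolution A (A Xstar) (-1) Z W)
    (hrank : (estimate Z + tangent Z W₀ - Xstar).rank ≤ 2 * r) :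
    ‖tangent Z W - tangent Z W₀‖ ≤ 8 / (1 - δ) * ‖estimate Z + tangent Z W₀ - Xstar‖ := by
  obtain ⟨hδ'0, -, hRIP⟩ := hA
  set N := estimate Z + tangent Z W₀ - Xstar with hN
  have hobj : ∀ V : Factors n₁ n₂ r, objective A (A Xstar) (-1) Z V =
      ‖A (estimate Z + tangent Z V - Xstar)‖ ^ 2 := fun V => by
    rw [objective, ← map_sub, estimate, tangent, neg_one_smul, sub_neg_eq_add, add_comm (Z.1 * Z.2ᵀ)]
  have h1 : ‖A (estimate Z + tangent Z W - Xstar)‖ ≤ ‖A N‖ := by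
    have h := hW W₀
    rw [hobj, hobj] at h
    exact le_of_sq_le_sq h (norm_nonneg _)
  have h2 : ‖A (tangent Z W - tangent Z W₀)‖ ≤ 2 * ‖A N‖ := by
    have h : tangent Z W - tangent Z W₀ = (estimate Z + tangent Z W - Xstar) - N := by
      rw [hN]; abel
    rw [h, map_sub]
    linarith [norm_sub_le (A (estimate Z + tangent Z W - Xstar)) (A N)]
  have h3 := (hRIP (tangent Z W - tangent Z W₀)
    (by rw [← tangent_sub]; exact tangent_rank_le _ _)).1
  have h4 := (hRIP N hrank).2
  have hd : 0 < 1 - δ := by linarith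
  have hκ : 1 ≤ 8 / (1 - δ) := by
    rw [le_div_iff₀ hd]
    linarith
  have h5 : ‖A (tangent Z W - tangent Z W₀)‖ ^ 2 ≤ (2 * ‖A N‖) ^ 2 :=
    pow_le_pow_left₀ (norm_nonneg _) h2 2
  have h6 : (1 - δ) * ‖tangent Z W - tangent Z W₀‖ ^ 2 ≤ 8 * ‖N‖ ^ 2 := by
    nlinarith [sq_nonneg ‖tangent Z W - tangent Z W₀‖, sq_nonneg ‖N‖]
  refine le_of_sq_le_sq ?_ (by positivity)
  calc ‖tangent Z W - tangent Z W₀‖ ^ 2 ≤ 8 * ‖N‖ ^ 2 / (1 - δ) := by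
        rw [le_div_iff₀ hd]; linarith
    _ = 8 / (1 - δ) * 1 * ‖N‖ ^ 2 := by ring
    _ ≤ 8 / (1 - δ) * (8 / (1 - δ)) * ‖N‖ ^ 2 := by gcongr
    _ = _ := by ring

/-- The constant of the quadratic bounds for a single step. -/
noncomputable def stepConst (δ : ℝ) : ℝ := 1 + 8 / (1 - δ) + 8 * (2 + 8 / (1 - δ)) ^ 2

theorem le_stepConst (hδ1 : δ < 1) : 5 / 2 ≤ stepConst δ := by
  have hd : 0 < 1 - δ := by linarith
  have hκ : 0 ≤ 8 / (1 - δ) := by positivity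
  rw [stepConst]
  nlinarith

/-- One step from nearly balanced factors close to `X*`: the error becomes quadratically small, and
the imbalance `Uᵀ U - Vᵀ V` grows at most by a multiple of the squared error. -/
theorem step_bounds (hδ1 : δ < 1) (hA : SatisfiesRIP A (2 * r) δ') (hδ' : δ' ≤ δ) (hr : 0 < r)
    {Xstar : Matrix (Fin n₁) (Fin n₂) ℝ} (hX : Xstar.rank = r) {Z W : Factors n₁ n₂ r}
    (hW : IsMinNormSolution A (A Xstar) (-1) Z W)
    (hE : ‖estimate Z - Xstar‖ ≤ sigma r Xstar / 10)
    (hB : ‖Z.1ᵀ * Z.1 - Z.2ᵀ * Z.2‖ ≤ sigma r Xstar / 10) :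
    ‖estimate (Z + W) - Xstar‖ ≤ stepConst δ / sigma r Xstar * ‖estimate Z - Xstar‖ ^ 2 ∧
      ‖(Z + W).1ᵀ * (Z + W).1 - (Z + W).2ᵀ * (Z + W).2‖ ≤ ‖Z.1ᵀ * Z.1 - Z.2ᵀ * Z.2‖ +
        stepConst δ / sigma r Xstar * ‖estimate Z - Xstar‖ ^ 2 := by
  have hσ : 0 < sigma r Xstar := sigma_pos hr hX
  obtain ⟨Y, Q, hYQ, hQ, hY⟩ := exists_reduced_svd hX
  set σ := sigma r Xstar
  set e := ‖estimate Z - Xstar‖ with he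
  have he0 : 0 ≤ e := norm_nonneg _
  have hd : 0 < 1 - δ := by linarith
  set κ := 8 / (1 - δ) with hκ
  have hκ0 : 0 < κ := by positivity
  have hτ : 0 < √σ / 2 := by positivity
  obtain ⟨hU, hV⟩ := boundedBelow_of_near_of_balanced hσ hQ hY (U := Z.1) (V := Z.2)
    (by rw [← hYQ]; exact hE) hB
  obtain ⟨P, R, hP, hP2, hR, hR2, hPU, hVR, hfit⟩ := exists_tangent_eq hτ hU hV
  have hPX : (1 - P) * estimate Z = 0 := by
    rw [estimate, ← Matrix.mul_assoc, hPU, Matrix.zero_mul]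
  have hXR : estimate Z * (1 - R) = 0 := by
    rw [estimate, Matrix.mul_assoc, hVR, Matrix.mul_zero]
  obtain ⟨W₀, hW₀, -, -⟩ := hfit (Xstar - estimate Z)
  have hres : ‖(1 - P) * (Xstar - estimate Z) * (1 - R)‖ ≤ e ^ 2 / σ := by
    have h := norm_residual_le hσ hQ hY hP hP2 hR hR2 hPX hXR
    rwa [← hYQ] at h
  have hN : estimate Z + tangent Z W₀ - Xstar = -((1 - P) * (Xstar - estimate Z) * (1 - R)) := by
    rw [hW₀]; abel
  have hrank : (estimate Z + tangent Z W₀ - Xstar).rank ≤ 2 * r := by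
    have h : estimate Z + tangent Z W₀ - Xstar = (-(1 - P)) * Xstar * (1 - R) := by
      rw [hN, Matrix.mul_sub (1 - P), hPX, sub_zero, Matrix.neg_mul, Matrix.neg_mul]
    rw [h]
    have h1 := rank_mul_le_left ((-(1 - P)) * Xstar) (1 - R)
    have h2 := rank_mul_le_right (-(1 - P)) Xstar
    omega
  have hdiff := norm_tangent_sub_le hδ1 hA hδ' hW.1 hrank
  have hNle : ‖estimate Z + tangent Z W₀ - Xstar‖ ≤ e ^ 2 / σ := by rwa [hN, norm_neg]
  have hdiff' : ‖tangent Z W - tangent Z W₀‖ ≤ κ * (e ^ 2 / σ) :=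
    hdiff.trans (mul_le_mul_of_nonneg_left hNle hκ0.le)
  have heσ : e ^ 2 / σ ≤ e := by
    rw [div_le_iff₀ hσ, sq]
    exact mul_le_mul_of_nonneg_left (by linarith) he0
  have hT : ‖tangent Z W‖ ≤ (2 + κ) * e := by
    have h1 : ‖tangent Z W₀‖ ≤ e + e := by
      have h := norm_sub_le (Xstar - estimate Z) ((1 - P) * (Xstar - estimate Z) * (1 - R))
      have h' := norm_sub_projections_le hP hP2 hR hR2 (Xstar - estimate Z)
      rw [norm_sub_rev Xstar, ← he] at h h'
      rw [hW₀]
      linarith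
    have h2 := norm_add_le (tangent Z W - tangent Z W₀) (tangent Z W₀)
    rw [sub_add_cancel] at h2
    have h3 : κ * (e ^ 2 / σ) ≤ κ * e := mul_le_mul_of_nonneg_left heσ hκ0.le
    linarith
  have hsq : sqNorm W ≤ 8 * (2 + κ) ^ 2 * (e ^ 2 / σ) := by
    obtain ⟨W', hW', h1, h2⟩ := hfit (tangent Z W)
    have hz : (1 - P) * tangent Z W * (1 - R) = 0 := by
      rw [tangent, Matrix.mul_add, ← Matrix.mul_assoc, hPU, Matrix.zero_mul, zero_add,
        Matrix.mul_assoc, Matrix.mul_assoc, hVR, Matrix.mul_zero, Matrix.mul_zero]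
    rw [hz, sub_zero] at hW'
    refine (hW.sqNorm_le hW').trans ?_
    have hb : 1 / (√σ / 2) * ‖tangent Z W‖ ≤ 1 / (√σ / 2) * ((2 + κ) * e) := by gcongr
    have h3 := pow_le_pow_left₀ (norm_nonneg _) (h1.trans hb) 2
    have h4 := pow_le_pow_left₀ (norm_nonneg _) (h2.trans hb) 2
    have h5 : (1 / (√σ / 2) * ((2 + κ) * e)) ^ 2 = 4 * (2 + κ) ^ 2 * (e ^ 2 / σ) := by
      rw [mul_pow, div_pow, div_pow, Real.sq_sqrt hσ.le]
      field_simp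
      ring
    rw [sqNorm]
    linarith
  have hC : stepConst δ / σ * e ^ 2 =
      e ^ 2 / σ + κ * (e ^ 2 / σ) + 8 * (2 + κ) ^ 2 * (e ^ 2 / σ) := by
    rw [stepConst, ← hκ]; ring
  have hpos : 0 ≤ e ^ 2 / σ := by positivity
  constructor
  · have h : estimate (Z + W) - Xstar = (estimate Z + tangent Z W₀ - Xstar) +
        (tangent Z W - tangent Z W₀) + W.1 * W.2ᵀ := by
      rw [estimate_add]; abel
    rw [h, hC]
    refine norm_add₃_le.trans ?_
    have := (norm_mul_transpose_le_sqNorm W).trans hsq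
    linarith
  · rw [hW.balance_add, hC]
    refine (norm_add_le _ _).trans ?_
    have := (norm_balance_le_sqNorm W).trans hsq
    have := mul_nonneg hκ0.le hpos
    linarith

end Step

/-! ### The iterates -/

section Iteration

variable {n₁ n₂ m r : ℕ} {A : Matrix (Fin n₁) (Fin n₂) ℝ →ₗ[ℝ] EuclideanSpace ℝ (Fin m)}
  {δ δ' : ℝ}

theorem iterates_neg_one_succ (b : EuclideanSpace ℝ (Fin m)) (Z₀ : Factors n₁ n₂ r) (t : ℕ) :
    iterates A b (-1) Z₀ (t + 1) =
      iterates A b (-1) Z₀ t + minNormSolution A b (-1) (iterates A b (-1) Z₀ t) := by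
  rw [iterates]
  norm_num

/-- The quadratic contraction of the error along the iterates, together with the geometric decay
that keeps them in the region where it applies. The imbalance alone may grow; it is
controlled because adding `2 C e² / σ` to it gives a nonincreasing quantity. -/
theorem iterates_bounds (hδ1 : δ < 1) (hA : SatisfiesRIP A (2 * r) δ') (hδ' : δ' ≤ δ) (hr : 0 < r)
    {Xstar : Matrix (Fin n₁) (Fin n₂) ℝ} (hX : Xstar.rank = r) {c : ℝ}
    (hc : 4 * stepConst δ ≤ c) {Z₀ : Factors n₁ n₂ r}
    (hZ₀ : Z₀ ∈ errBall r Xstar (1 / c) ∩ balancedSet r Xstar (1 / (2 * c))) (t : ℕ) :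
    ‖estimate (iterates A (A Xstar) (-1) Z₀ (t + 1)) - Xstar‖ ≤
        c / (2 * sigma r Xstar) * ‖estimate (iterates A (A Xstar) (-1) Z₀ t) - Xstar‖ ^ 2 ∧
      ‖estimate (iterates A (A Xstar) (-1) Z₀ t) - Xstar‖ ≤
        (1 / 2) ^ t * ‖estimate Z₀ - Xstar‖ := by
  set x := iterates A (A Xstar) (-1) Z₀ with hx
  set err : ℕ → ℝ := fun t => ‖estimate (x t) - Xstar‖ with herr
  set bal : ℕ → ℝ := fun t => ‖(x t).1ᵀ * (x t).1 - (x t).2ᵀ * (x t).2‖ with hbal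
  have hσ : 0 < sigma r Xstar := sigma_pos hr hX
  set σ := sigma r Xstar with hσdef
  set C := stepConst δ with hCdef
  have hC : 5 / 2 ≤ C := le_stepConst hδ1
  have hc0 : 0 < c := by linarith
  have hσc : σ / c ≤ σ / 10 := div_le_div_of_nonneg_left hσ.le (by norm_num) (by linarith)
  have herr0 : ∀ t, 0 ≤ err t := fun t => norm_nonneg _
  have hbal0 : ∀ t, 0 ≤ bal t := fun t => norm_nonneg _
  -- `C e² / σ ≤ e / 4`, as `e ≤ σ / c` and `4 C ≤ c`
  have hquad : ∀ e : ℝ, 0 ≤ e → e ≤ σ / c → C / σ * e ^ 2 ≤ e / 4 := by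
    intro e he hle
    have h1 : C / σ * e ≤ 1 / 4 := by
      rw [le_div_iff₀ hc0] at hle
      rw [div_mul_eq_mul_div, div_le_iff₀ hσ]
      nlinarith
    nlinarith
  have hstep : ∀ t, err t ≤ σ / c → bal t ≤ σ / c →
      err (t + 1) ≤ C / σ * err t ^ 2 ∧ bal (t + 1) ≤ bal t + C / σ * err t ^ 2 := by
    intro t h1 h2
    have h := step_bounds hδ1 hA hδ' hr hX (isMinNormSolution_minNormSolution A (A Xstar) (-1) (x t))
      (h1.trans hσc) (h2.trans hσc)
    rwa [hx, ← iterates_neg_one_succ] at h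
  have hinv : ∀ t, err t ≤ σ / c ∧ bal t + 2 * (C / σ * err t ^ 2) ≤ σ / c ∧
      err t ≤ (1 / 2) ^ t * err 0 := by
    intro t
    induction t with
    | zero =>
      have h1 : err 0 ≤ σ / c := by
        have h : err 0 ≤ 1 / c * σ := hZ₀.1
        rwa [one_div_mul_eq_div] at h
      have h2 : bal 0 ≤ σ / c / 2 := by
        have h : bal 0 ≤ 1 / (2 * c) * σ := hZ₀.2
        rwa [one_div_mul_eq_div, mul_comm, ← div_div] at h
      refine ⟨h1, ?_, by simp⟩
      linarith [hquad _ (herr0 0) h1]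
    | succ t ih =>
      obtain ⟨h1, h2, h3⟩ := ih
      have hpos : 0 ≤ C / σ * err t ^ 2 := by positivity
      obtain ⟨h4, h5⟩ := hstep t h1 (by linarith)
      have h6 := hquad _ (herr0 t) h1
      have h7 := herr0 t
      have h8 : err (t + 1) ≤ err t / 2 := by linarith
      have h9 : C / σ * err (t + 1) ^ 2 ≤ C / σ * (err t / 2) ^ 2 := by
        have := herr0 (t + 1)
        gcongr
      refine ⟨by linarith, by linarith, ?_⟩
      rw [pow_succ]
      linarith
  obtain ⟨h1, h2, h3⟩ := hinv t
  refine ⟨?_, h3⟩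
  have hpos : 0 ≤ C / σ * err t ^ 2 := by positivity
  refine (hstep t h1 (by linarith)).1.trans ?_
  have h4 : C / σ ≤ c / (2 * σ) := by
    rw [div_le_div_iff₀ hσ (by positivity)]
    nlinarith
  exact mul_le_mul_of_nonneg_right h4 (sq_nonneg _)

theorem tendsto_of_geometric_bound {Xstar : Matrix (Fin n₁) (Fin n₂) ℝ}
    {x : ℕ → Matrix (Fin n₁) (Fin n₂) ℝ} {K : ℝ}
    (h : ∀ t, ‖x t - Xstar‖ ≤ (1 / 2) ^ t * K) :
    Filter.Tendsto x Filter.atTop (𝓝 Xstar) := by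
  refine tendsto_iff_norm_sub_tendsto_zero.2 (squeeze_zero (fun t => norm_nonneg _) h ?_)
  have h1 := (tendsto_pow_atTop_nhds_zero_of_lt_one (r := (1 / 2 : ℝ)) (by norm_num)
    (by norm_num)).mul_const K
  rwa [zero_mul] at h1

end Iteration

end GNMR

theorem theorem1 (δ : ℝ) (hδ0 : 0 < δ) (hδ1 : δ < 1) :
    ∃ c₀ : ℝ, 0 < c₀ ∧ ∀ cₑ : ℝ, c₀ ≤ cₑ →
      ∀ (n₁ n₂ m r : ℕ)
        (A : Matrix (Fin n₁) (Fin n₂) ℝ →ₗ[ℝ] EuclideanSpace ℝ (Fin m))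
        (δ₂ᵣ : ℝ), GNMR.SatisfiesRIP A (2 * r) δ₂ᵣ → δ₂ᵣ ≤ δ →
      ∀ Xstar : Matrix (Fin n₁) (Fin n₂) ℝ, Xstar.rank = r →
      ∀ Z₀ : GNMR.Factors n₁ n₂ r,
        Z₀ ∈ GNMR.errBall r Xstar (1 / cₑ) ∩ GNMR.balancedSet r Xstar (1 / (2 * cₑ)) →
        (∀ t : ℕ,
          ‖GNMR.estimate (GNMR.iterates A (A Xstar) (-1) Z₀ (t + 1)) - Xstar‖ ≤
            cₑ / (2 * GNMR.sigma r Xstar) *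
              ‖GNMR.estimate (GNMR.iterates A (A Xstar) (-1) Z₀ t) - Xstar‖ ^ 2) ∧
        Filter.Tendsto (fun t : ℕ => GNMR.estimate (GNMR.iterates A (A Xstar) (-1) Z₀ t))
          Filter.atTop (𝓝 Xstar) := by
  have hC := GNMR.le_stepConst hδ1
  refine ⟨4 * GNMR.stepConst δ, by linarith, ?_⟩
  intro cₑ hc n₁ n₂ m r A δ₂ᵣ hA hδ' Xstar hX Z₀ hZ₀
  rcases Nat.eq_zero_or_pos r with rfl | hr
  · -- for `r = 0` both `X*` and all estimates vanish
    have hzero : ∀ Z : GNMR.Factors n₁ n₂ 0, GNMR.estimate Z = 0 := fun Z => by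
      ext i j
      simp [GNMR.estimate, Matrix.mul_apply]
    obtain ⟨Y, Q, hXstar, -⟩ := GNMR.exists_reduced_svd hX
    have hest : ∀ Z : GNMR.Factors n₁ n₂ 0, GNMR.estimate Z = Xstar := fun Z => by
      rw [hzero, hXstar]
      exact (hzero (Y, Q)).symm
    simp only [hest]
    exact ⟨fun t => by simp, tendsto_const_nhds⟩
  · have hb := GNMR.iterates_bounds hδ1 hA hδ' hr hX hc hZ₀
    exact ⟨fun t => (hb t).1, GNMR.tendsto_of_geometric_bound fun t => (hb t).2⟩
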